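/- A cartesian closed category is a category with finite products in which, for every object $T$, the functor $T\times(-)$ has a right adjoint $(-)^T$; an object $T$ of such a category is called atomic if the exponential functor $(-)^T$ itself has a right adjoint. Let $E=\{1,e\}$ be the monoid with unit $1$ and exactly one other element $e$, which is idempotent ($e^2=e$), regarded as a category with one object, and let $\mathbf{Set}^E$ be the topos of functors $E\to\mathbf{Set}$. Then $\mathbf{Set}^E$ has no atomic objects except the terminal object $1$; that is, an object $T$ of $\mathbf{Set}^E$ is atomic if and only if $T$ is terminal (isomorphic to $1$). -/

import Mathlib

open CategoryTheory CategoryTheory.Limits MonoidalCategory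

universe u v w

/-- The monoid `{1, e}` whose only non-identity element `e` is idempotent. -/
inductive IdemMonoid : Type
  | one : IdemMonoid
  | e : IdemMonoid

namespace IdemMonoid

/-- Multiplication: `1` is the unit and `e * e = e`. -/
def mul : IdemMonoid → IdemMonoid → IdemMonoid
  | one, y => y
  | e, _ => e

instance : Monoid IdemMonoid where
  mul := mul
  one := one
  mul_assoc := by rintro (_ | _) (_ | _) (_ | _) <;> rfl
  one_mul := by rintro (_ | _) <;> rfl
  mul_one := by rintro (_ | _) <;> rfl

end IdemMonoid

/-- The topos `Set^E` of functors from the one-object category of `E = {1, e}` to sets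
(sets of an arbitrary universe `u`). -/
abbrev SetE : Type (u + 1) := SingleObj IdemMonoid ⥤ Type u

/-- `Set^E` is cartesian closed: its tensor product is the cartesian product, and `ihom T` is the
exponential functor `(-)^T`, right adjoint to `T × (-)`. -/
noncomputable instance : MonoidalClosed SetE.{u} :=
  FunctorToTypes.monoidalClosed.{u, 0, 0}

/-- An object `T` of a cartesian closed category is atomic if the exponential functor `(-)^T`
(itself a right adjoint of the product functor `T × (-)`) has a right adjoint `(-)_T`. -/
def IsAtomicObject {C : Type v} [Category.{w} C] [CartesianMonoidalCategory C]
    [MonoidalClosed C] (T : C) : Prop :=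
  (ihom T).IsLeftAdjoint

/-!
If `T` is atomic then `(-)^T` preserves jointly epimorphic families, so maps out of `T × y(c)`, with
`y(c)` corepresentable, lift through every such family, as maps out of `y(c)` do. Apply this to the
identity of `T × y(c)` and the family of all maps `y(d) ⟶ T × y(c)`: the product `T × y(c)` is
generated by a single element `(t₀, s)`, with `s : c ⟶ d`. Acting on `t₀`, which lies over `d`, by
any map `d ⟶ c` shows that `T` is inhabited at `c`. Each element `(t, 𝟙 c)` equals `r • (t₀, s)` for
some `r` with `s ≫ r = 𝟙 c`; when the retraction `r` of `s` is unique, so is `t = r • t₀`. In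
`{1, e}` uniqueness holds because one-sided inverses are two-sided.
-/

section JointlyEpi

/-- A family of morphisms with common codomain is jointly epimorphic if a morphism out of the
codomain is determined by its composites with the members of the family. -/
def JointlyEpi {C : Type*} [Category* C] {ι : Type*} {X : ι → C} {Y : C}
    (p : ∀ i, X i ⟶ Y) : Prop :=
  ∀ ⦃Z : C⦄ (g h : Y ⟶ Z), (∀ i, p i ≫ g = p i ≫ h) → g = h

namespace JointlyEpi

lemma map {C D : Type*} [Category* C] [Category* D] {ι : Type*} {X : ι → C} {Y : C}
    {p : ∀ i, X i ⟶ Y} (hp : JointlyEpi p) (F : C ⥤ D) [F.IsLeftAdjoint] :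
    JointlyEpi fun i => F.map (p i) := by
  intro Z g h hgh
  let adj := Adjunction.ofIsLeftAdjoint F
  refine (adj.homEquiv Y Z).injective (hp _ _ fun i => ?_)
  rw [← adj.homEquiv_naturality_left, ← adj.homEquiv_naturality_left, hgh i]

variable {C : Type u} [Category.{v} C] {ι : Type*}

lemma iSup_range_eq_top {X : ι → C ⥤ Type w} {Y : C ⥤ Type w} {p : ∀ i, X i ⟶ Y}
    (hp : JointlyEpi p) : ⨆ i, Subfunctor.range (p i) = ⊤ := by
  let S : Subfunctor Y := ⨆ i, Subfunctor.range (p i)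
  have : Epi S.ι := ⟨fun g h hgh => hp g h fun i => by
    have hi : Subfunctor.range (p i) ≤ S := le_iSup (fun i => Subfunctor.range (p i)) i
    rw [← Subfunctor.lift_ι (p i) hi, Category.assoc, Category.assoc, hgh]⟩
  rw [← Subfunctor.range_eq_top S.ι, Subfunctor.range_ι]

lemma exists_app_eq {X : ι → C ⥤ Type w} {Y : C ⥤ Type w} {p : ∀ i, X i ⟶ Y}
    (hp : JointlyEpi p) {c : C} (y : Y.obj c) : ∃ i x, (p i).app c x = y := by
  have hy : y ∈ (⨆ i, Subfunctor.range (p i)).obj c := by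
    rw [hp.iSup_range_eq_top]
    trivial
  simpa only [Subfunctor.iSup_obj, Set.mem_iUnion, Subfunctor.range_obj, Set.mem_range] using hy

end JointlyEpi

lemma jointlyEpi_uliftCoyonedaEquiv_symm {C : Type u} [Category.{v} C] (P : C ⥤ Type (max w v)) :
    JointlyEpi fun x : Σ c : Cᵒᵖ, P.obj c.unop => uliftCoyonedaEquiv.{w}.symm x.2 := by
  refine fun Z g h hgh => hom_ext_uliftCoyoneda.{w} fun c p => ?_
  simpa only [Equiv.symm_apply_apply] using hgh ⟨c, uliftCoyonedaEquiv p⟩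

end JointlyEpi

section IndecomposableProjective

/-- An object `P` is indecomposable projective if every morphism from `P` to the common codomain of
a jointly epimorphic family, indexed by a type in the universe `t`, lifts to a member of the family.
For `t` large enough, such functors to sets are the retracts of the corepresentable ones. -/
def IsIndecomposableProjective.{t, v', u'} {C : Type u'} [Category.{v'} C] (P : C) : Prop :=
  ∀ ⦃ι : Type t⦄ ⦃X : ι → C⦄ ⦃Y : C⦄ ⦃p : ∀ i, X i ⟶ Y⦄, JointlyEpi p →
    ∀ φ : P ⟶ Y, ∃ i, ∃ ψ : P ⟶ X i, ψ ≫ p i = φ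

variable {C : Type u} [Category.{v} C]

lemma isIndecomposableProjective_uliftCoyoneda (c : Cᵒᵖ) :
    IsIndecomposableProjective (uliftCoyoneda.{w}.obj c) := by
  intro ι X Y p hp φ
  obtain ⟨i, x, hx⟩ := hp.exists_app_eq (uliftCoyonedaEquiv φ)
  refine ⟨i, uliftCoyonedaEquiv.symm x, uliftCoyonedaEquiv.injective ?_⟩
  rw [uliftCoyonedaEquiv_comp, Equiv.apply_symm_apply, hx]

lemma IsIndecomposableProjective.exists_generator {P : C ⥤ Type (max w v)}
    (hP : IsIndecomposableProjective.{max u w v} P) :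
    ∃ (d : C) (x : P.obj d), ∀ {a : C} (y : P.obj a), ∃ f : d ⟶ a, P.map f x = y := by
  obtain ⟨⟨d, x⟩, ψ, hψ⟩ := hP (jointlyEpi_uliftCoyonedaEquiv_symm P) (𝟙 P)
  exact ⟨d.unop, x, fun {a} y =>
    ⟨(ψ.app a y).down, ConcreteCategory.congr_hom (NatTrans.congr_app hψ a) y⟩⟩

end IndecomposableProjective

namespace IsAtomicObject

lemma of_isTerminal {C : Type*} [Category* C] [CartesianMonoidalCategory C] [MonoidalClosed C]
    {T : C} (hT : IsTerminal T) : IsAtomicObject T := by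
  let e : T ≅ 𝟙_ C := hT.uniqueUpToIso CartesianMonoidalCategory.isTerminalTensorUnit
  let α : tensorLeft T ≅ 𝟭 C := (tensoringLeft C).mapIso e ≪≫ leftUnitorNatIso C
  have : (tensorLeft T).IsEquivalence := Functor.isEquivalence_of_iso α.symm
  have : (ihom T).IsEquivalence := (ihom.adjunction T).isEquivalence_right_of_isEquivalence_left
  exact Functor.isLeftAdjoint_of_isEquivalence

lemma isIndecomposableProjective_tensor {C : Type*} [Category* C] [CartesianMonoidalCategory C]
    [MonoidalClosed C] {T P : C} (hT : IsAtomicObject T)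
    (hP : IsIndecomposableProjective.{w} P) : IsIndecomposableProjective.{w} (T ⊗ P) := by
  intro ι X Y p hp φ
  have : (ihom T).IsLeftAdjoint := hT
  obtain ⟨i, ψ, hψ⟩ := hP (hp.map (ihom T)) (MonoidalClosed.curry φ)
  refine ⟨i, MonoidalClosed.uncurry ψ, ?_⟩
  rw [← MonoidalClosed.uncurry_natural_right, hψ, MonoidalClosed.uncurry_curry]

variable {C : Type u} [Category.{v} C] [MonoidalClosed (C ⥤ Type (max w v))]
  {T : C ⥤ Type (max w v)}

lemma exists_retraction_map_eq (hT : IsAtomicObject T) (c : C) :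
    ∃ (d : C) (s : c ⟶ d) (t₀ : T.obj d), ∀ t : T.obj c, ∃ r : d ⟶ c, s ≫ r = 𝟙 c ∧
      T.map r t₀ = t := by
  have hP : IsIndecomposableProjective (T ⊗ uliftCoyoneda.{w}.obj (.op c)) :=
    hT.isIndecomposableProjective_tensor (isIndecomposableProjective_uliftCoyoneda (.op c))
  obtain ⟨d, ⟨t₀, ⟨s⟩⟩, hx⟩ := hP.exists_generator
  refine ⟨d, s, t₀, fun t => ?_⟩
  obtain ⟨r, hr⟩ := hx (a := c) (t, ⟨𝟙 c⟩)
  exact ⟨r, congrArg (fun y => y.2.down) hr, congrArg Prod.fst hr⟩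

lemma nonempty_obj (hT : IsAtomicObject T) {c : C} (hc : ∀ d : C, Nonempty (d ⟶ c)) :
    Nonempty (T.obj c) := by
  obtain ⟨d, -, t₀, -⟩ := hT.exists_retraction_map_eq c
  exact (hc d).map fun f => T.map f t₀

lemma subsingleton_obj (hT : IsAtomicObject T) {c : C}
    (hc : ∀ {d : C} (s : c ⟶ d), Subsingleton (SplitMono s)) : Subsingleton (T.obj c) := by
  obtain ⟨d, s, t₀, ht₀⟩ := hT.exists_retraction_map_eq c
  refine ⟨fun t t' => ?_⟩
  obtain ⟨r, hr, rfl⟩ := ht₀ t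
  obtain ⟨r', hr', rfl⟩ := ht₀ t'
  have hrr' : r = r' :=
    congrArg SplitMono.retraction ((hc s).elim ⟨r, hr⟩ ⟨r', hr'⟩)
  rw [hrr']

end IsAtomicObject

lemma subsingleton_splitMono_singleObj {M : Type*} [Monoid M] [IsDedekindFiniteMonoid M]
    {c d : SingleObj M} (s : c ⟶ d) : Subsingleton (SplitMono s) := by
  refine ⟨fun ⟨r, hr⟩ ⟨r', hr'⟩ => ?_⟩
  have hrr' : r = r' := left_inv_eq_right_inv (M := M) hr (mul_eq_one_symm (M := M) hr')
  simp only [hrr']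

instance : IsDedekindFiniteMonoid IdemMonoid where
  mul_eq_one_symm := by rintro (_ | _) (_ | _) h <;> exact h

theorem theoremT_general {C : Type u} [Category.{v} C] [MonoidalClosed (C ⥤ Type (max w v))]
    (hom_nonempty : ∀ c d : C, Nonempty (c ⟶ d))
    (retraction_unique : ∀ {c d : C} (s : c ⟶ d), Subsingleton (SplitMono s))
    (T : C ⥤ Type (max w v)) : IsAtomicObject T ↔ Nonempty (IsTerminal T) := by
  refine ⟨fun hT => ?_, fun ⟨hT⟩ => .of_isTerminal hT⟩
  refine ⟨Functor.isTerminal fun c => (Types.isTerminalEquivUnique _).symm ?_⟩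
  have := hT.subsingleton_obj (c := c) retraction_unique
  exact uniqueOfSubsingleton (hT.nonempty_obj fun d => hom_nonempty d c).some

theorem theoremT (T : SetE.{u}) : IsAtomicObject T ↔ Nonempty (IsTerminal T) :=
  theoremT_general.{0, 0, u} (fun _ _ => ⟨IdemMonoid.one⟩) subsingleton_splitMono_singleObj T
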